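/- **Proposition 4.1.** Let $n,m$ be natural numbers, let $U\subset\mathbb R^m$ be nonempty and compact, and let $\mathcal C\subset\mathbb R^n$ be nonempty and closed with compact boundary. Let $f:\mathbb R^n\times U\to\mathbb R^n$ and $l:\mathbb R^n\times U\to[0,+\infty)$ be continuous, with $x\mapsto f(x,u)$ and $x\mapsto l(x,u)$ locally Lipschitz continuous uniformly with respect to $u\in U$ (no growth condition on $f$ is assumed). Write $\mathbf d(x)$ for the Euclidean distance of $x$ from $\mathcal C$. For $z\in\mathbb R^n\setminus\mathcal C$ and a Lebesgue measurable control $u:[0,+\infty)\to U$, let $x(\cdot\,,u,z)$ be the unique (locally absolutely continuous) solution of $\dot x(t)=f(x(t),u(t))$ for a.e. $t$, $x(0)=z$, on its maximal interval $[0,T^{\max})$, $T^{\max}\le+\infty$. The control $u$ is *admissible from $z$*, written $u\in\mathcal U(z)$, if there is $T_z(u)$ with $0<T_z(u)\le T^{\max}$ such that $x(t,u,z)\notin\mathcal C$ for all $t\in[0,T_z(u))$ and, if $T_z(u)<+\infty$, $\lim_{t\to T_z(u)^-}\mathbf d(x(t,u,z))=0$; this $T_z(u)\in(0,+\infty]$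 is then unique. Let $p_0:(0,+\infty)\to[0,1]$ be continuous and increasing (not necessarily strictly), and let $\gamma:(0,+\infty)\to(0,+\infty)$ be continuous and strictly increasing. Let $W:\overline{\mathbb R^n\setminus\mathcal C}\to[0,+\infty)$ be a continuous Minimum Restraint function (MRF) for $p_0$ and $\gamma$, that is: $W$ is continuous; $W>0$ on $\mathbb R^n\setminus\mathcal C$ and $W=0$ on its boundary; $W^{-1}(K)$ is compact for every compact $K\subset[0,+\infty)$; and $$\min_{u\in U}\big\{\langle p,f(x,u)\rangle+p_0(W(x))\,l(x,u)\big\}\le-\gamma(W(x))\qquad\text{for all }x\in\mathbb R^n\setminus\mathcal C,\ p\in\partial_PW(x),$$ where $\partial_PW(x)$ is the proximal subdifferential: $p\in\partial_PW(x)$ if and only if there are $\sigma$ and $\eta>0$ with $W(y)-W(x)+\sigma|y-x|^2\ge\langle p,y-x\rangle$ whenever $|y-x|\le\eta$. Then, for every $z\in\mathbb R^n\setminus\mathcal C$, with $x(\cdot):=x(\cdot\,,u,z)$, $$W(z)\ \ge\ \inf_{u\in\mathcal U(z)}\ \sup_{0\le T<T_z(u)}\left\{\int_0^T\big[p_0(W(x(t)))\,l(x(t),u(t))+\gamma(W(x(t)))\big]\,dt+W(x(T))\right\},$$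 where the infimum and the supremum are taken in $[-\infty,+\infty]$ (so that the inequality includes $\mathcal U(z)\ne\emptyset$). -/

import Mathlib

open MeasureTheory Set Filter Topology

noncomputable section

namespace RegulatedCost

variable {n m : ℕ} {U : Set (EuclideanSpace ℝ (Fin m))}

/-- `x ↦ g (x, u)` is locally Lipschitz continuous, uniformly with respect to `u ∈ U`. -/
def LocLipUnif {F : Type*} [PseudoEMetricSpace F]
    (g : EuclideanSpace ℝ (Fin n) × U → F) : Prop :=
  ∀ x₀ : EuclideanSpace ℝ (Fin n), ∃ K : NNReal, ∃ N ∈ 𝓝 x₀,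
    ∀ u : U, LipschitzOnWith K (fun x => g (x, u)) N

/-- Controls: Lebesgue measurable functions `[0, +∞) → U`.  (The values at negative times play no
role, and almost everywhere equality with a Borel function is Lebesgue measurability.) -/
def IsControl (u : ℝ → U) : Prop :=
  AEMeasurable u (volume.restrict (Ici (0 : ℝ)))

/-- `x` is a Carathéodory solution on `[0, τ)` of `x' = f(x, u)`, `x(0) = z`: it is absolutely
continuous on the compact subintervals and satisfies the equation almost everywhere. -/
structure IsSolutionOn (f : EuclideanSpace ℝ (Fin n) × U → EuclideanSpace ℝ (Fin n))
    (z : EuclideanSpace ℝ (Fin n)) (u : ℝ → U) (τ : EReal)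
    (x : ℝ → EuclideanSpace ℝ (Fin n)) : Prop where
  initial : x 0 = z
  absCont : ∀ t : ℝ, 0 ≤ t → (t : EReal) < τ → AbsolutelyContinuousOnInterval x 0 t
  ode : ∀ᵐ t : ℝ, 0 < t → (t : EReal) < τ → HasDerivAt x (f (x t, u t)) t

/-- The maximal existence time `T^max ≤ +∞`. -/
def maxTime (f : EuclideanSpace ℝ (Fin n) × U → EuclideanSpace ℝ (Fin n))
    (z : EuclideanSpace ℝ (Fin n)) (u : ℝ → U) : EReal :=
  sSup {τ : EReal | ∃ x, IsSolutionOn f z u τ x}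

/-- The trajectory `x(·, u, z)`: the solution on the maximal interval `[0, T^max)` (under the
standing assumptions on `f` it exists and its values on `[0, T^max)` are unique; only these values
are used below). -/
def trajectory (f : EuclideanSpace ℝ (Fin n) × U → EuclideanSpace ℝ (Fin n))
    (z : EuclideanSpace ℝ (Fin n)) (u : ℝ → U) : ℝ → EuclideanSpace ℝ (Fin n) :=
  Classical.epsilon fun x => IsSolutionOn f z u (maxTime f z u) x

/-- `T ∈ (0, +∞]` is a time as required in the definition of an admissible control: the trajectory
exists and stays outside the target `C` on `[0, T)`, and, if `T < +∞`, its distance from `C`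
tends to `0` as `t → T⁻`. -/
structure IsTargetTime (f : EuclideanSpace ℝ (Fin n) × U → EuclideanSpace ℝ (Fin n))
    (C : Set (EuclideanSpace ℝ (Fin n))) (z : EuclideanSpace ℝ (Fin n)) (u : ℝ → U)
    (T : EReal) : Prop where
  pos : 0 < T
  le_maxTime : T ≤ maxTime f z u
  notMem : ∀ t : ℝ, 0 ≤ t → (t : EReal) < T → trajectory f z u t ∉ C
  tendsto : ∀ T' : ℝ, T = (T' : EReal) →
    Tendsto (fun t => Metric.infDist (trajectory f z u t) C) (𝓝[<] T') (𝓝 0)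

/-- The set `𝒰(z)` of the controls that are admissible from `z`. -/
def admissibleControls (f : EuclideanSpace ℝ (Fin n) × U → EuclideanSpace ℝ (Fin n))
    (C : Set (EuclideanSpace ℝ (Fin n))) (z : EuclideanSpace ℝ (Fin n)) : Set (ℝ → U) :=
  {u | IsControl u ∧ ∃ T : EReal, IsTargetTime f C z u T}

/-- The time `T_z(u)` of an admissible control (for such a control, and a closed nonempty `C`,
exactly one `T` satisfies `IsTargetTime f C z u T`, and it is the value of this supremum). -/
def targetTime (f : EuclideanSpace ℝ (Fin n) × U → EuclideanSpace ℝ (Fin n))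
    (C : Set (EuclideanSpace ℝ (Fin n))) (z : EuclideanSpace ℝ (Fin n)) (u : ℝ → U) : EReal :=
  sSup {T : EReal | IsTargetTime f C z u T}

/-- The proximal subdifferential `∂_P W(x)` at an interior point `x` of the domain of `W`
(`η` may be shrunk, so only the values of `W` near `x` matter). -/
def proximalSubdiff (W : EuclideanSpace ℝ (Fin n) → ℝ) (x : EuclideanSpace ℝ (Fin n)) :
    Set (EuclideanSpace ℝ (Fin n)) :=
  {p | ∃ σ : ℝ, ∃ η : ℝ, 0 < η ∧ ∀ y, dist y x ≤ η →
    inner ℝ p (y - x) ≤ W y - W x + σ * ‖y - x‖ ^ 2}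

/-- The Hamiltonian `H(x, q, p) = min_{u ∈ U} (⟨p, f(x,u)⟩ + q l(x,u))`; `U` is nonempty and
compact and `f`, `l` are continuous wherever it is used, so that the infimum is a minimum. -/
def hamiltonian (f : EuclideanSpace ℝ (Fin n) × U → EuclideanSpace ℝ (Fin n))
    (l : EuclideanSpace ℝ (Fin n) × U → ℝ) (x : EuclideanSpace ℝ (Fin n)) (q : ℝ)
    (p : EuclideanSpace ℝ (Fin n)) : ℝ :=
  ⨅ u : U, (inner ℝ p (f (x, u)) + q * l (x, u))

/-- `W`, regarded as a function on `closure Cᶜ`, is a continuous Minimum Restraint function for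
the dynamics `f` and the running cost `l` with target `C`, for the functions `p₀` and `γ` (regarded
as functions on `(0, +∞)`). -/
structure IsMRF (f : EuclideanSpace ℝ (Fin n) × U → EuclideanSpace ℝ (Fin n))
    (l : EuclideanSpace ℝ (Fin n) × U → ℝ) (C : Set (EuclideanSpace ℝ (Fin n)))
    (p₀ γ : ℝ → ℝ) (W : EuclideanSpace ℝ (Fin n) → ℝ) : Prop where
  p₀_cont : ContinuousOn p₀ (Ioi 0)
  p₀_mono : MonotoneOn p₀ (Ioi 0)
  p₀_mem : ∀ r, 0 < r → p₀ r ∈ Icc (0 : ℝ) 1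
  γ_cont : ContinuousOn γ (Ioi 0)
  γ_strictMono : StrictMonoOn γ (Ioi 0)
  γ_pos : ∀ r, 0 < r → 0 < γ r
  W_cont : ContinuousOn W (closure Cᶜ)
  W_pos : ∀ x ∈ Cᶜ, 0 < W x
  W_zero : ∀ x ∈ frontier Cᶜ, W x = 0
  W_proper : ∀ K : Set ℝ, K ⊆ Ici 0 → IsCompact K → IsCompact (closure Cᶜ ∩ W ⁻¹' K)
  decrease : ∀ x ∈ Cᶜ, ∀ p ∈ proximalSubdiff W x,
    hamiltonian f l x (p₀ (W x)) p ≤ -γ (W x)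

end RegulatedCost

end

/-!
Fix `ε > 0`. A control is built which is admissible from `z` and along which `W(x(T))` plus the cost
accumulated up to `T` never exceeds `W z + ε`; this is all that the infimum requires.

The control is piecewise constant and comes from the inf-convolution
`V(x) = min {W y + a ‖y - x‖² | y ∈ S}` of `W` over a compact shell `S` around
`{w/2 ≤ W ≤ 3w/2}`. If `y` is a minimizer for `V(x)`, `p = 2a (x - y)` is a proximal subgradient
of `W` at `y` (`smul_sub_mem_proximalSubdiff`), so the decrease condition provides a control value
`v` with `⟨p, f(y, v)⟩ + p₀(W y) l(y, v) < -γ(W y) + ε'`. Along the curve `c` from `x` with constant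
control `v`, `V(c t) ≤ W y + a ‖y - c t‖²`, with equality at `t = 0`, and the derivative of the
right-hand side is close to `⟨p, f(y, v)⟩`: the error `‖p‖ ‖x - y‖ = 2a ‖x - y‖² ≤ 2 (W x - W y)` is
controlled by the modulus of continuity of `W`. Since `γ ∘ W` is bounded below on the shell, `ε'`
can be absorbed by giving away a small fraction `η` of the cost, so that `V` decreases by at least
`1 - η` times the cost, for a duration `δ` that is uniform on the shell
(`IsMRF.exists_descent_step`). Finitely many such steps halve `W` at an error as small as desired
(`IsMRF.exists_arc_halving`).

Repeating this with errors `ε / 2 ^ (k + 1)` yields a sequence of arcs, each extending the previous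
one, on which `W → 0` (`IsMRF.exists_arc_sequence`). Their union is a solution up to the supremum of
the end times. If this supremum is finite, then properness of `W` turns `W → 0` into convergence of
the distance to the target, so the control is admissible (`IsMRF.exists_admissible_control`).

The trajectory and the target time of the statement are a choice of a maximal solution and a
supremum. They are identified with the constructed objects through uniqueness of Carathéodory
solutions, a Gronwall argument for absolutely continuous functions (`IsSolutionOn.eq`), which also
shows that the maximal time is attained (`exists_isSolutionOn_maxTime`).
-/

/-! ### Carathéodory solutions: uniqueness, the maximal solution, the target time -/

namespace RegulatedCost

theorem LocLipUnif.exists_lipschitzOnWith_of_isCompact {n m : ℕ}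
    {U : Set (EuclideanSpace ℝ (Fin m))} (hU : IsCompact U)
    {F : Type*} [PseudoMetricSpace F] {g : EuclideanSpace ℝ (Fin n) × U → F}
    (hg : Continuous g) (hgL : LocLipUnif g) {S : Set (EuclideanSpace ℝ (Fin n))}
    (hS : IsCompact S) :
    ∃ K : NNReal, ∀ u : U, LipschitzOnWith K (fun x => g (x, u)) S := by
  have : CompactSpace U := isCompact_iff_compactSpace.mp hU
  let G : EuclideanSpace ℝ (Fin n) → C(U, F) := fun x => ⟨fun u => g (x, u), by fun_prop⟩
  have hG : LocallyLipschitzOn S G := by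
    intro x₀ _
    obtain ⟨K, N, hN, hK⟩ := hgL x₀
    refine ⟨K, N, mem_nhdsWithin_of_mem_nhds hN, LipschitzOnWith.of_dist_le_mul fun x hx y hy => ?_⟩
    rw [ContinuousMap.dist_le (by positivity)]
    exact fun u => (hK u).dist_le_mul x hx y hy
  obtain ⟨K, hK⟩ := hG.exists_lipschitzOnWith_of_compact hS
  refine ⟨K, fun u => LipschitzOnWith.of_dist_le_mul fun x hx y hy => ?_⟩
  exact (ContinuousMap.dist_apply_le_dist (f := G x) (g := G y) u).trans (hK.dist_le_mul x hx y hy)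

theorem _root_.AbsolutelyContinuousOnInterval.congr_of_eqOn {X : Type*} [PseudoMetricSpace X]
    {f g : ℝ → X} {a b : ℝ} (hf : AbsolutelyContinuousOnInterval f a b)
    (hfg : EqOn f g (uIcc a b)) : AbsolutelyContinuousOnInterval g a b := by
  rw [absolutelyContinuousOnInterval_iff] at hf ⊢
  intro ε hε
  obtain ⟨δ, hδ, h⟩ := hf ε hε
  refine ⟨δ, hδ, fun E hE hlen => ?_⟩
  convert h E hE hlen using 1
  refine Finset.sum_congr rfl fun i hi => ?_
  have := hE.1 i (Finset.mem_range.mp hi |> fun h => by simpa using h)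
  rw [hfg this.1, hfg this.2]

theorem _root_.AbsolutelyContinuousOnInterval.norm {F : Type*} [SeminormedAddCommGroup F]
    {f : ℝ → F} {a b : ℝ} (hf : AbsolutelyContinuousOnInterval f a b) :
    AbsolutelyContinuousOnInterval (fun t => ‖f t‖) a b := by
  refine squeeze_zero (fun t => Finset.sum_nonneg fun i _ => dist_nonneg) (fun t => ?_) hf
  gcongr with i _
  simp only [dist_eq_norm]
  exact abs_norm_sub_norm_le _ _

/-- Gronwall's lemma for an absolutely continuous function with values in an inner product
space. -/
theorem _root_.AbsolutelyContinuousOnInterval.eq_zero_of_norm_deriv_le {F : Type*}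
    [NormedAddCommGroup F] [InnerProductSpace ℝ F] {h h' : ℝ → F} {b K : ℝ} (hb : 0 ≤ b)
    (hac : AbsolutelyContinuousOnInterval h 0 b) (h0 : h 0 = 0)
    (hd : ∀ᵐ t : ℝ, 0 < t → t < b → HasDerivAt h (h' t) t ∧ ‖h' t‖ ≤ K * ‖h t‖) :
    h b = 0 := by
  have hq : AbsolutelyContinuousOnInterval
      (fun t => (‖h t‖ * ‖h t‖) * Real.exp (-(2 * K) * t)) 0 b := by
    refine (hac.norm.fun_mul hac.norm).fun_mul (ContDiffOn.absolutelyContinuousOnInterval ?_)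
    exact ContDiff.contDiffOn (by fun_prop)
  have hle : ∫ t in (0 : ℝ)..b,
      deriv (fun t => (‖h t‖ * ‖h t‖) * Real.exp (-(2 * K) * t)) t ≤ 0 := by
    have hae : ∀ᵐ t ∂(volume.restrict (Ioc 0 b)),
        deriv (fun t => (‖h t‖ * ‖h t‖) * Real.exp (-(2 * K) * t)) t ≤ 0 := by
      rw [← restrict_Ioo_eq_restrict_Ioc, ae_restrict_iff' measurableSet_Ioo]
      filter_upwards [hd] with t ht htm
      obtain ⟨hdt, hn⟩ := ht htm.1 htm.2
      have h1 : HasDerivAt (fun t => ‖h t‖ * ‖h t‖) (2 * inner ℝ (h t) (h' t)) t := by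
        simpa only [sq] using hdt.norm_sq
      have h2 : HasDerivAt (fun t => Real.exp (-(2 * K) * t))
          (Real.exp (-(2 * K) * t) * (-(2 * K))) t := by
        simpa using ((hasDerivAt_id t).const_mul (-(2 * K))).exp
      rw [(h1.fun_mul h2).deriv]
      have h3 : inner ℝ (h t) (h' t) ≤ ‖h t‖ * (K * ‖h t‖) :=
        (real_inner_le_norm _ _).trans (by gcongr)
      have h4 := Real.exp_pos (-(2 * K) * t)
      nlinarith [mul_le_mul_of_nonneg_right h3 h4.le]
    rw [intervalIntegral.integral_of_le hb]
    exact integral_nonpos_of_ae hae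
  rw [hq.integral_deriv_eq_sub] at hle
  simp only [h0, norm_zero, mul_zero, zero_mul, sub_zero] at hle
  have h5 := Real.exp_pos (-(2 * K) * b)
  have h6 : ‖h b‖ * ‖h b‖ ≤ 0 := by
    by_contra hcon
    exact absurd hle (not_le.mpr (mul_pos (not_le.mp hcon) h5))
  exact norm_eq_zero.mp (mul_self_eq_zero.mp (le_antisymm h6 (mul_self_nonneg _)))

variable {n m : ℕ} {U : Set (EuclideanSpace ℝ (Fin m))}
  {f : EuclideanSpace ℝ (Fin n) × U → EuclideanSpace ℝ (Fin n)}
  {z : EuclideanSpace ℝ (Fin n)} {u : ℝ → U} {τ τ' : EReal}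
  {x y : ℝ → EuclideanSpace ℝ (Fin n)}

theorem IsSolutionOn.eq (hU : IsCompact U) (hf : Continuous f) (hfL : LocLipUnif f)
    (hx : IsSolutionOn f z u τ x) (hy : IsSolutionOn f z u τ' y) {t : ℝ} (ht : 0 ≤ t)
    (htτ : (t : EReal) < τ) (htτ' : (t : EReal) < τ') : x t = y t := by
  have hxa := hx.absCont t ht htτ
  have hya := hy.absCont t ht htτ'
  have hxc := hxa.continuousOn
  have hyc := hya.continuousOn
  rw [uIcc_of_le ht] at hxc hyc
  obtain ⟨K, hK⟩ := hfL.exists_lipschitzOnWith_of_isCompact hU hf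
    ((isCompact_Icc.image_of_continuousOn hxc).union (isCompact_Icc.image_of_continuousOn hyc))
  refine sub_eq_zero.mp ((hxa.fun_sub hya).eq_zero_of_norm_deriv_le
    (h' := fun s => f (x s, u s) - f (y s, u s)) (K := K) ht
    (by rw [hx.initial, hy.initial, sub_self]) ?_)
  filter_upwards [hx.ode, hy.ode] with s hxs hys h0 hst
  have hsτ : (s : EReal) < t := EReal.coe_lt_coe_iff.mpr hst
  refine ⟨(hxs h0 (hsτ.trans htτ)).sub (hys h0 (hsτ.trans htτ')), ?_⟩
  rw [← dist_eq_norm, ← dist_eq_norm]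
  exact (hK (u s)).dist_le_mul _ (Or.inl ⟨s, ⟨h0.le, hst.le⟩, rfl⟩) _
    (Or.inr ⟨s, ⟨h0.le, hst.le⟩, rfl⟩)

theorem IsSolutionOn.le_maxTime (hx : IsSolutionOn f z u τ x) : τ ≤ maxTime f z u :=
  le_sSup ⟨x, hx⟩

/-- The maximal existence time is attained: the solutions on shorter intervals agree where they
overlap, and countably many of them cover the maximal interval. -/
theorem exists_isSolutionOn_maxTime (hU : IsCompact U) (hf : Continuous f) (hfL : LocLipUnif f)
    (z : EuclideanSpace ℝ (Fin n)) (u : ℝ → U) :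
    ∃ x, IsSolutionOn f z u (maxTime f z u) x := by
  -- On `[0, 0)` the constant curve is a solution.
  have hne : {τ : EReal | ∃ x, IsSolutionOn f z u τ x}.Nonempty := by
    refine ⟨0, fun _ => z, rfl, fun t ht h => ?_, Eventually.of_forall fun t ht h => ?_⟩
    · exact absurd h (not_lt.mpr (by exact_mod_cast ht))
    · exact absurd h (not_lt.mpr (by exact_mod_cast ht.le))
  obtain ⟨σ, -, -, hσlim, hσmem⟩ := (isLUB_sSup _).exists_seq_monotone_tendsto hne
  choose X hX using hσmem
  have hcover : ∀ t : ℝ, (t : EReal) < maxTime f z u → ∃ k, (t : EReal) < σ k := fun t ht =>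
    (hσlim.eventually (lt_mem_nhds ht)).exists
  have hEq : Pairwise fun i j => EqOn (X i) (X j)
      ({t : ℝ | 0 ≤ t ∧ (t : EReal) < σ i} ∩ {t : ℝ | 0 ≤ t ∧ (t : EReal) < σ j}) :=
    fun i j _ t ht => (hX i).eq hU hf hfL (hX j) ht.1.1 ht.1.2 ht.2.2
  classical
  let k : ℝ → ℕ := fun t => if h : ∃ k, (t : EReal) < σ k then h.choose else 0
  have hk : ∀ t : ℝ, (t : EReal) < maxTime f z u → (t : EReal) < σ (k t) := fun t ht => by
    have h := hcover t ht
    simp only [k, dif_pos h]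
    exact h.choose_spec
  have hle : ∀ i, σ i ≤ maxTime f z u := fun i => (hX i).le_maxTime
  have hglue : ∀ i, ∀ t : ℝ, 0 ≤ t → (t : EReal) < σ i → X (k t) t = X i t := fun i t ht hti =>
    (hX _).eq hU hf hfL (hX i) ht (hk t (hti.trans_le (hle i))) hti
  refine ⟨fun t => X (k t) t, (hX _).initial, fun t ht htm => ?_, ?_⟩
  · obtain ⟨i, hi⟩ := hcover t htm
    refine ((hX i).absCont t ht hi).congr_of_eqOn fun s hs => ?_
    rw [uIcc_of_le ht] at hs
    exact (hglue i s hs.1 ((EReal.coe_le_coe_iff.mpr hs.2).trans_lt hi)).symm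
  · filter_upwards [ae_all_iff.mpr fun i => (hX i).ode] with t ht h0 htm
    obtain ⟨i, hi⟩ := hcover t htm
    have hd := ht i h0 hi
    rw [hglue i t h0.le hi]
    refine hd.congr_of_eventuallyEq ?_
    have hopen : IsOpen {s : ℝ | (s : EReal) < σ i} :=
      isOpen_Iio.preimage continuous_coe_real_ereal
    filter_upwards [hopen.mem_nhds hi, lt_mem_nhds h0] with s hs hs0
    exact hglue i s hs0.le hs

theorem isSolutionOn_trajectory (hU : IsCompact U) (hf : Continuous f) (hfL : LocLipUnif f)
    (z : EuclideanSpace ℝ (Fin n)) (u : ℝ → U) :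
    IsSolutionOn f z u (maxTime f z u) (trajectory f z u) :=
  Classical.epsilon_spec (exists_isSolutionOn_maxTime hU hf hfL z u)

theorem IsSolutionOn.trajectory_eq (hU : IsCompact U) (hf : Continuous f) (hfL : LocLipUnif f)
    (hx : IsSolutionOn f z u τ x) {t : ℝ} (ht : 0 ≤ t) (htτ : (t : EReal) < τ) :
    trajectory f z u t = x t :=
  (isSolutionOn_trajectory hU hf hfL z u).eq hU hf hfL hx ht (htτ.trans_le hx.le_maxTime) htτ

theorem IsTargetTime.le (hU : IsCompact U) (hf : Continuous f) (hfL : LocLipUnif f)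
    {C : Set (EuclideanSpace ℝ (Fin n))} (hC : IsClosed C) (hC' : C.Nonempty) {T T' : EReal}
    (hT : IsTargetTime f C z u T) (hT' : IsTargetTime f C z u T') : T ≤ T' := by
  by_contra! hlt
  -- The trajectory is defined and continuous at the finite time `T'`, so it lies in `C` there.
  obtain ⟨s, rfl⟩ : ∃ s : ℝ, T' = s := by
    induction T' with
    | bot => exact absurd hT'.pos (by simp)
    | coe s => exact ⟨s, rfl⟩
    | top => exact absurd hlt (by simp)
  have hs0 : 0 < s := by exact_mod_cast hT'.pos
  have hsol := isSolutionOn_trajectory hU hf hfL z u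
  have hcont := (hsol.absCont s hs0.le (hlt.trans_le hT.le_maxTime)).continuousOn
  rw [uIcc_of_le hs0.le] at hcont
  have h1 : Tendsto (trajectory f z u) (𝓝[<] s) (𝓝 (trajectory f z u s)) :=
    (hcont s ⟨hs0.le, le_rfl⟩).tendsto.mono_left
      (nhdsWithin_le_iff.mpr (Icc_mem_nhdsLT hs0))
  have h2 := ((Metric.continuous_infDist_pt C).tendsto _).comp h1
  have h3 := tendsto_nhds_unique h2 (hT'.tendsto s rfl)
  exact hT.notMem s hs0.le hlt ((hC.mem_iff_infDist_zero hC').mpr h3)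

theorem IsTargetTime.targetTime_eq (hU : IsCompact U) (hf : Continuous f) (hfL : LocLipUnif f)
    {C : Set (EuclideanSpace ℝ (Fin n))} (hC : IsClosed C) (hC' : C.Nonempty) {T : EReal}
    (hT : IsTargetTime f C z u T) : targetTime f C z u = T :=
  le_antisymm (sSup_le fun _ h => h.le hU hf hfL hC hC' hT) (le_sSup hT)

end RegulatedCost

/-! ### Integral curves and inf-convolutions -/

namespace RegulatedCost

/-- A Lipschitz autonomous vector field bounded by `B` on the ball of radius `B * δ` has an integral
curve on `[0, δ]` which stays in that ball; it is extended to the whole line by constants. -/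
theorem exists_integralCurve {E : Type*} [NormedAddCommGroup E] [NormedSpace ℝ E]
    [CompleteSpace E] {g : E → E} {x : E} {B K : NNReal} {δ : ℝ} (hδ : 0 ≤ δ)
    (hg : LipschitzOnWith K g (Metric.closedBall x (B * δ)))
    (hB : ∀ y ∈ Metric.closedBall x (B * δ), ‖g y‖ ≤ B) :
    ∃ c : ℝ → E, Continuous c ∧ c 0 = x ∧ (∀ t, c t ∈ Metric.closedBall x (B * δ)) ∧
      ∀ t ∈ Ioo 0 δ, HasDerivAt c (g (c t)) t := by
  lift δ to NNReal using hδ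
  have hpl : IsPicardLindelof (fun _ => g) (tmin := 0) (tmax := (δ : ℝ)) ⟨0, by simp⟩ x
      (B * δ) 0 B K :=
    IsPicardLindelof.of_time_independent (by simpa using hB) (by simpa using hg) (by simp)
  obtain ⟨α, hα⟩ :=
    ODE.FunSpace.exists_isFixedPt_next hpl (x := x) (Metric.mem_closedBall_self le_rfl)
  refine ⟨α.compProj, α.continuous_compProj, ?_, fun t => ?_, fun t ht => ?_⟩
  · have h0 := ODE.FunSpace.compProj_of_mem (α := α) (left_mem_Icc.mpr δ.2)
    rw [h0]
    nth_rw 1 [← hα]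
    exact ODE.FunSpace.next_apply₀ _ _ _
  · simpa using α.compProj_mem_closedBall hpl.mul_max_le (t := t)
  · have hd : HasDerivWithinAt α.compProj (g (α.compProj t)) (Icc 0 δ) t := by
      apply ODE.hasDerivWithinAt_picard_Icc (t₀ := 0) (by simp) hpl.continuousOn_uncurry
        α.continuous_compProj.continuousOn
        (fun _ _ => α.compProj_mem_closedBall hpl.mul_max_le) x ⟨ht.1.le, ht.2.le⟩
        |>.congr_of_mem _ ⟨ht.1.le, ht.2.le⟩
      intro t' ht'
      nth_rw 1 [← hα]
      rw [ODE.FunSpace.compProj_of_mem ht', ODE.FunSpace.next_apply]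
    exact hd.hasDerivAt (Icc_mem_nhds ht.1 ht.2)

section InfConvolution

variable {n : ℕ} {W : EuclideanSpace ℝ (Fin n) → ℝ} {S : Set (EuclideanSpace ℝ (Fin n))}

/-- The quadratic inf-convolution `x ↦ inf {W y + a ‖y - x‖² | y ∈ S}` of `W` over the set `S`. -/
noncomputable def infConv (W : EuclideanSpace ℝ (Fin n) → ℝ) (S : Set (EuclideanSpace ℝ (Fin n)))
    (a : ℝ) (x : EuclideanSpace ℝ (Fin n)) : ℝ :=
  sInf ((fun y => W y + a * ‖y - x‖ ^ 2) '' S)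

theorem exists_infConv_eq (hS : IsCompact S) (hS' : S.Nonempty) (hW : ContinuousOn W S) (a : ℝ)
    (x : EuclideanSpace ℝ (Fin n)) :
    ∃ y ∈ S, infConv W S a x = W y + a * ‖y - x‖ ^ 2 := by
  have hc : ContinuousOn (fun y => W y + a * ‖y - x‖ ^ 2) S := by fun_prop
  obtain ⟨y, hy, h⟩ := hS.exists_sInf_image_eq hS' hc
  exact ⟨y, hy, h⟩

theorem infConv_le (hS : IsCompact S) (hW : ContinuousOn W S) (a : ℝ)
    (x : EuclideanSpace ℝ (Fin n)) {y : EuclideanSpace ℝ (Fin n)} (hy : y ∈ S) :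
    infConv W S a x ≤ W y + a * ‖y - x‖ ^ 2 := by
  have hc : ContinuousOn (fun y => W y + a * ‖y - x‖ ^ 2) S := by fun_prop
  exact csInf_le (hS.bddBelow_image hc) ⟨y, hy, rfl⟩

/-- A minimizer `y` in the definition of the inf-convolution at `x` carries the proximal
subgradient `2a (x - y)` of `W`. -/
theorem smul_sub_mem_proximalSubdiff {a : ℝ} {x y : EuclideanSpace ℝ (Fin n)} (hS : S ∈ 𝓝 y)
    (hmin : ∀ y' ∈ S, W y + a * ‖y - x‖ ^ 2 ≤ W y' + a * ‖y' - x‖ ^ 2) :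
    (2 * a) • (x - y) ∈ proximalSubdiff W y := by
  obtain ⟨η, hη, hball⟩ := Metric.nhds_basis_closedBall.mem_iff.mp hS
  refine ⟨a, η, hη, fun y' hy' => ?_⟩
  have h1 := hmin y' (hball hy')
  have h2 : ‖y' - x‖ ^ 2 = ‖y' - y‖ ^ 2 - 2 * inner ℝ (x - y) (y' - y) + ‖y - x‖ ^ 2 := by
    rw [show y' - x = (y' - y) - (x - y) by abel, norm_sub_sq_real, norm_sub_rev y x,
      real_inner_comm]
  rw [real_inner_smul_left]
  rw [h2] at h1
  linarith

end InfConvolution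

end RegulatedCost

/-! ### Descent of the inf-convolution along one curve -/

namespace RegulatedCost

variable {n m : ℕ} {U : Set (EuclideanSpace ℝ (Fin m))}
  {f : EuclideanSpace ℝ (Fin n) × U → EuclideanSpace ℝ (Fin n)}
  {l : EuclideanSpace ℝ (Fin n) × U → ℝ} {C : Set (EuclideanSpace ℝ (Fin n))}
  {p₀ γ : ℝ → ℝ} {W : EuclideanSpace ℝ (Fin n) → ℝ}

/-- The integrand `p₀(W(x)) l(x,u) + γ(W(x))` of the regulated cost. -/
def costRate (l : EuclideanSpace ℝ (Fin n) × U → ℝ) (p₀ γ : ℝ → ℝ)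
    (W : EuclideanSpace ℝ (Fin n) → ℝ) (y : EuclideanSpace ℝ (Fin n) × U) : ℝ :=
  p₀ (W y.1) * l y + γ (W y.1)

theorem IsMRF.continuousOn (hW : IsMRF f l C p₀ γ W) : ContinuousOn W Cᶜ :=
  hW.W_cont.mono subset_closure

theorem IsMRF.continuousOn_costRate (hW : IsMRF f l C p₀ γ W) (hl : Continuous l) :
    ContinuousOn (costRate l p₀ γ W) (Cᶜ ×ˢ univ) := by
  have h1 : ContinuousOn (fun y : EuclideanSpace ℝ (Fin n) × U => W y.1) (Cᶜ ×ˢ univ) :=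
    hW.continuousOn.comp continuousOn_fst fun y hy => hy.1
  have h2 : MapsTo (fun y : EuclideanSpace ℝ (Fin n) × U => W y.1) (Cᶜ ×ˢ univ) (Ioi 0) :=
    fun y hy => hW.W_pos _ hy.1
  exact ((hW.p₀_cont.comp h1 h2).mul hl.continuousOn).add (hW.γ_cont.comp h1 h2)

theorem IsMRF.γ_le_costRate (hW : IsMRF f l C p₀ γ W) (hl0 : ∀ y, 0 ≤ l y)
    {y : EuclideanSpace ℝ (Fin n) × U} (hy : y.1 ∉ C) : γ (W y.1) ≤ costRate l p₀ γ W y :=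
  le_add_of_nonneg_left (mul_nonneg (hW.p₀_mem _ (hW.W_pos _ hy)).1 (hl0 y))

theorem IsMRF.costRate_pos (hW : IsMRF f l C p₀ γ W) (hl0 : ∀ y, 0 ≤ l y)
    {y : EuclideanSpace ℝ (Fin n) × U} (hy : y.1 ∉ C) : 0 < costRate l p₀ γ W y :=
  (hW.γ_pos _ (hW.W_pos _ hy)).trans_le (hW.γ_le_costRate hl0 hy)

/-- Points of `closure Cᶜ` where `W ≠ 0` lie outside the target. -/
theorem IsMRF.notMem_of_ne_zero (hW : IsMRF f l C p₀ γ W) {x : EuclideanSpace ℝ (Fin n)}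
    (hx : x ∈ closure Cᶜ) (h0 : W x ≠ 0) : x ∉ C := by
  intro hxC
  refine h0 (hW.W_zero x ⟨hx, fun hint => ?_⟩)
  exact interior_subset hint hxC

/-- The level shell `{w/2 ≤ W ≤ 3w/2}` has a uniform closed neighbourhood inside a compact subset
of the shell `{w/4 < W < 2w}`. -/
theorem IsMRF.exists_isCompact_shell (hW : IsMRF f l C p₀ γ W) (hC : IsClosed C) {w : ℝ}
    (hw : 0 < w) :
    ∃ S : Set (EuclideanSpace ℝ (Fin n)), IsCompact S ∧ S ⊆ Cᶜ ∧
      (∀ y ∈ S, w / 4 < W y ∧ W y < 2 * w) ∧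
      ∃ r : ℝ, 0 < r ∧ ∀ x, x ∉ C → w / 2 ≤ W x → W x ≤ 3 * w / 2 →
        Metric.closedBall x r ⊆ S := by
  have hK := hW.W_proper (Icc (w / 2) (3 * w / 2))
    (fun t ht => (by linarith [ht.1] : (0 : ℝ) ≤ t)) isCompact_Icc
  have hO : IsOpen (Cᶜ ∩ W ⁻¹' Ioo (w / 4) (2 * w)) :=
    hW.continuousOn.isOpen_inter_preimage hC.isOpen_compl isOpen_Ioo
  have hKO : closure Cᶜ ∩ W ⁻¹' Icc (w / 2) (3 * w / 2) ⊆ Cᶜ ∩ W ⁻¹' Ioo (w / 4) (2 * w) := by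
    rintro x ⟨hx, h1, h2⟩
    exact ⟨hW.notMem_of_ne_zero hx (by linarith), by linarith, by linarith⟩
  obtain ⟨r, hr, hrO⟩ := hK.exists_cthickening_subset_open hO hKO
  refine ⟨_, hK.cthickening, fun y hy => (hrO hy).1, fun y hy => (hrO hy).2, r, hr,
    fun x hx h1 h2 => ?_⟩
  have hxK : x ∈ closure Cᶜ ∩ W ⁻¹' Icc (w / 2) (3 * w / 2) := ⟨subset_closure hx, h1, h2⟩
  exact Metric.closedBall_subset_cthickening hxK r

/-- The derivative of `a ‖c - y‖²` along a curve whose velocity `fc` is close to the velocity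
`fy` of the nearby minimizer `y`, compared with the decrease of the Hamiltonian at `y`. -/
theorem two_mul_inner_add_le {E : Type*} [NormedAddCommGroup E] [InnerProductSpace ℝ E]
    {x y c fc fy : E} {a Λ ρ B s ε η Rc Ry : ℝ} (ha : 0 ≤ a) (hΛ : 0 ≤ Λ)
    (hham : inner ℝ ((2 * a) • (x - y)) fy + Ry ≤ ε)
    (hlip : ‖fc - fy‖ ≤ Λ * ‖c - y‖) (hfc : ‖fc‖ ≤ B) (hcx : ‖c - x‖ ≤ s) (hxy : ‖x - y‖ ≤ ρ)
    (h1 : 2 * Λ * (a * ‖x - y‖ ^ 2) ≤ ε) (h2 : 2 * a * ρ * Λ * s ≤ ε) (h3 : 2 * a * s * B ≤ ε)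
    (hR : Rc ≤ Ry + ε) (hη : 5 * ε ≤ η * Rc) :
    a * (2 * inner ℝ (c - y) fc) + (1 - η) * Rc ≤ 0 := by
  have hs : 0 ≤ s := (norm_nonneg _).trans hcx
  have e1 : a * (2 * inner ℝ (c - y) fc) = inner ℝ ((2 * a) • (x - y)) fy
      + 2 * a * inner ℝ (x - y) (fc - fy) + 2 * a * inner ℝ (c - x) fc := by
    rw [real_inner_smul_left, inner_sub_right, show c - y = (c - x) + (x - y) by abel,
      inner_add_left]
    ring
  have e2 : inner ℝ (x - y) (fc - fy) ≤ ‖x - y‖ * (Λ * (s + ‖x - y‖)) := by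
    refine (real_inner_le_norm _ _).trans ?_
    gcongr
    refine hlip.trans ?_
    gcongr
    rw [show c - y = (c - x) + (x - y) by abel]
    exact (norm_add_le _ _).trans (by gcongr)
  have e3 : inner ℝ (c - x) fc ≤ s * B := (real_inner_le_norm _ _).trans (by gcongr)
  have e4 : 2 * a * inner ℝ (x - y) (fc - fy) ≤ 2 * a * (‖x - y‖ * (Λ * (s + ‖x - y‖))) := by
    gcongr
  have e5 : 2 * a * inner ℝ (c - x) fc ≤ 2 * a * (s * B) := by gcongr
  have e6 : 2 * a * ‖x - y‖ * Λ * s ≤ 2 * a * ρ * Λ * s := by gcongr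
  nlinarith

/-- One step of the descent. On the shell `{w/2 ≤ W ≤ 3w/2}` there are an approximation `V` of `W`
and a duration `δ` such that from each point some constant control makes `V` decrease, over
`[0, δ]`, by at least `1 - η` times the accumulated cost. -/
theorem IsMRF.exists_descent_step (hW : IsMRF f l C p₀ γ W) (hU : IsCompact U) (hU' : U.Nonempty)
    (hC : IsClosed C) (hf : Continuous f) (hfL : LocLipUnif f) (hl : Continuous l)
    (hl0 : ∀ y, 0 ≤ l y) {w η ω : ℝ} (hw : 0 < w) (hη : 0 < η) (hω : 0 < ω) :
    ∃ V : EuclideanSpace ℝ (Fin n) → ℝ, ∃ δ : ℝ, 0 < δ ∧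
      ∀ x, x ∉ C → w / 2 ≤ W x → W x ≤ 3 * w / 2 → V x ≤ W x ∧
        ∃ v : U, ∃ c : ℝ → EuclideanSpace ℝ (Fin n), Continuous c ∧ c 0 = x ∧
          (∀ t ∈ Ioo 0 δ, HasDerivAt c (f (c t, v)) t) ∧
          ∀ t ∈ Icc 0 δ, c t ∉ C ∧ w / 4 ≤ W (c t) ∧ W (c t) ≤ V (c t) + ω ∧
            V (c t) + (1 - η) * ∫ s in (0 : ℝ)..t, costRate l p₀ γ W (c s, v) ≤ V x := by
  have hUc : CompactSpace U := isCompact_iff_compactSpace.mp hU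
  have hUn : Nonempty U := hU'.to_subtype
  obtain ⟨S, hS, hSC, hSW, r, hr, hrS⟩ := hW.exists_isCompact_shell hC hw
  have hWS : ContinuousOn W S := hW.continuousOn.mono hSC
  have hRS : ContinuousOn (costRate l p₀ γ W) (S ×ˢ univ) :=
    (hW.continuousOn_costRate hl).mono (prod_mono_left hSC)
  have hSU : IsCompact (S ×ˢ (univ : Set U)) := hS.prod isCompact_univ
  obtain ⟨Λ, hΛ⟩ := hfL.exists_lipschitzOnWith_of_isCompact hU hf hS
  obtain ⟨B, hB⟩ : ∃ B : NNReal, ∀ y ∈ S, ∀ u : U, ‖f (y, u)‖ ≤ B := by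
    obtain ⟨B, hB⟩ := hSU.exists_bound_of_continuousOn hf.continuousOn
    exact ⟨B.toNNReal, fun y hy u =>
      (hB (y, u) ⟨hy, mem_univ _⟩).trans (Real.le_coe_toNNReal B)⟩
  -- The tolerance `ε` is a fifth of the part of the decay rate that is given away.
  set ε : ℝ := η * γ (w / 4) / 5 with hε_def
  have hγ : 0 < γ (w / 4) := hW.γ_pos _ (by linarith)
  have hε : 0 < ε := by positivity
  have hω₁ : 0 < min ω (ε / (2 * Λ + 1)) := lt_min hω (by positivity)
  obtain ⟨r₁, hr₁, hmodW⟩ := Metric.uniformContinuousOn_iff.mp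
    (hS.uniformContinuousOn_of_continuous hWS) _ hω₁
  obtain ⟨r₂, hr₂, hmodR⟩ := Metric.uniformContinuousOn_iff.mp
    (hSU.uniformContinuousOn_of_continuous hRS) _ hε
  obtain ⟨ρ, hρ, hρr, hρ₁, hρ₂⟩ : ∃ ρ : ℝ, 0 < ρ ∧ ρ < r ∧ ρ < r₁ ∧ 2 * ρ < r₂ := by
    refine ⟨min r (min r₁ r₂) / 3, by positivity, ?_, ?_, ?_⟩
    all_goals
      have h1 := min_le_left r (min r₁ r₂)
      have h2 := (min_le_right r (min r₁ r₂)).trans (min_le_left _ _)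
      have h3 := (min_le_right r (min r₁ r₂)).trans (min_le_right _ _)
      linarith
  -- With this weight the minimizers lie within `ρ`, since `W` varies by less than `2w` on `S`.
  set a : ℝ := 2 * w / ρ ^ 2 with ha_def
  have ha : 0 < a := by positivity
  have hmin : ∀ x ∈ S, ∃ y ∈ S, infConv W S a x = W y + a * ‖y - x‖ ^ 2 ∧ ‖y - x‖ ≤ ρ ∧
      a * ‖y - x‖ ^ 2 ≤ W x - W y ∧ W x - W y < min ω (ε / (2 * Λ + 1)) := by
    intro x hx
    obtain ⟨y, hy, hVy⟩ := exists_infConv_eq hS ⟨x, hx⟩ hWS a x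
    have h1 : a * ‖y - x‖ ^ 2 ≤ W x - W y := by
      have := infConv_le hS hWS a x hx
      rw [hVy] at this
      simp only [sub_self, norm_zero] at this
      linarith
    have h2 : ‖y - x‖ ≤ ρ := by
      have h3 : a * ‖y - x‖ ^ 2 ≤ a * ρ ^ 2 := by
        have : a * ρ ^ 2 = 2 * w := by rw [ha_def]; field_simp
        linarith [(hSW x hx).2, (hSW y hy).1]
      exact (sq_le_sq₀ (norm_nonneg _) hρ.le).mp (le_of_mul_le_mul_left h3 ha)
    refine ⟨y, hy, hVy, h2, h1, ?_⟩
    have h4 := hmodW x hx y hy (by rw [dist_comm, dist_eq_norm]; linarith)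
    rw [Real.dist_eq] at h4
    exact (le_abs_self _).trans_lt h4
  obtain ⟨δ, hδ, hδ₁, hδ₂, hδ₃⟩ : ∃ δ : ℝ, 0 < δ ∧ B * δ ≤ ρ ∧
      2 * a * ρ * Λ * (B * δ) ≤ ε ∧ 2 * a * (B * δ) * B ≤ ε := by
    have hsmall : ∀ k : ℝ, ∀ e : ℝ, 0 < e → ∀ᶠ δ : ℝ in 𝓝[>] 0, k * δ ≤ e := by
      intro k e he
      have : Tendsto (fun δ : ℝ => k * δ) (𝓝 0) (𝓝 0) :=
        Continuous.tendsto' (by fun_prop) _ _ (by simp)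
      exact ((this.eventually (gt_mem_nhds he)).mono fun _ h => h.le).filter_mono
        nhdsWithin_le_nhds
    obtain ⟨δ, h1, h2, h3, h4⟩ := ((hsmall B ρ hρ).and ((hsmall (2 * a * ρ * Λ * B) ε hε).and
      ((hsmall (2 * a * B * B) ε hε).and self_mem_nhdsWithin))).exists
    exact ⟨δ, h4, h1, by linarith, by linarith⟩
  refine ⟨infConv W S a, δ, hδ, fun x hx hx1 hx2 => ?_⟩
  have hball : Metric.closedBall x r ⊆ S := hrS x hx hx1 hx2
  have hxS : x ∈ S := hball (Metric.mem_closedBall_self hr.le)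
  obtain ⟨y, hy, hVx, hyx, hay, hWxy⟩ := hmin x hxS
  refine ⟨by rw [hVx]; linarith, ?_⟩
  have hyC : y ∉ C := hSC hy
  have hynhds : S ∈ 𝓝 y := by
    refine mem_of_superset (Metric.closedBall_mem_nhds_of_mem ?_) hball
    rw [Metric.mem_ball, dist_eq_norm]
    linarith
  have hp := smul_sub_mem_proximalSubdiff hynhds
    (fun y' hy' => hVx ▸ infConv_le hS hWS a x hy')
  -- An almost optimal control value for the Hamiltonian at the minimizer `y`.
  obtain ⟨v, hv⟩ := exists_lt_of_ciInf_lt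
    ((hW.decrease y hyC _ hp).trans_lt (lt_add_of_pos_right _ hε))
  have hballρ : Metric.closedBall x (B * δ) ⊆ S :=
    (Metric.closedBall_subset_closedBall (by linarith)).trans hball
  obtain ⟨c, hcc, hc0, hcmem, hcd⟩ := exists_integralCurve hδ.le ((hΛ v).mono hballρ)
    (fun y' hy' => hB y' (hballρ hy') v)
  have hcS : ∀ t, c t ∈ S := fun t => hballρ (hcmem t)
  refine ⟨v, c, hcc, hc0, hcd, fun t ht => ⟨hSC (hcS t), (hSW _ (hcS t)).1.le, ?_, ?_⟩⟩
  · obtain ⟨y', hy', hV', -, -, h'⟩ := hmin _ (hcS t)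
    rw [hV']
    have := min_le_left ω (ε / (2 * Λ + 1))
    have : 0 ≤ a * ‖y' - c t‖ ^ 2 := by positivity
    linarith
  · have hRc : Continuous fun s => costRate l p₀ γ W (c s, v) :=
      hRS.comp_continuous (by fun_prop) fun s => ⟨hcS s, mem_univ _⟩
    let φ : ℝ → ℝ := fun t =>
      a * ‖c t - y‖ ^ 2 + (1 - η) * ∫ s in (0 : ℝ)..t, costRate l p₀ γ W (c s, v)
    have hInt : ∀ s, HasDerivAt (fun t => ∫ s in (0 : ℝ)..t, costRate l p₀ γ W (c s, v))
        (costRate l p₀ γ W (c s, v)) s := fun s =>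
      intervalIntegral.integral_hasDerivAt_right (hRc.intervalIntegrable _ _)
        hRc.stronglyMeasurable.stronglyMeasurableAtFilter hRc.continuousAt
    have hφd : ∀ s ∈ Ioo 0 δ, HasDerivAt φ (a * (2 * inner ℝ (c s - y) (f (c s, v)))
        + (1 - η) * costRate l p₀ γ W (c s, v)) s := fun s hs =>
      ((((hcd s hs).sub_const y).norm_sq).const_mul a).add ((hInt s).const_mul (1 - η))
    have hφ : AntitoneOn φ (Icc 0 δ) := by
      refine antitoneOn_of_deriv_nonpos (convex_Icc _ _) ?_ ?_ ?_
      · refine Continuous.continuousOn ?_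
        have : Continuous fun t => ∫ s in (0 : ℝ)..t, costRate l p₀ γ W (c s, v) :=
          continuous_iff_continuousAt.mpr fun s => (hInt s).continuousAt
        fun_prop
      · rw [interior_Icc]
        exact fun s hs => (hφd s hs).differentiableAt.differentiableWithinAt
      · rw [interior_Icc]
        intro s hs
        rw [(hφd s hs).deriv]
        have hcx : ‖c s - x‖ ≤ B * δ := by
          rw [← dist_eq_norm]; exact hcmem s
        have hcy : ‖c s - y‖ ≤ 2 * ρ := by
          have := norm_sub_le_norm_sub_add_norm_sub (c s) x y
          rw [norm_sub_rev x y] at this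
          linarith
        refine two_mul_inner_add_le (x := x) (fy := f (y, v)) (Λ := Λ) (ρ := ρ) (B := B)
          (s := B * δ) (ε := ε) (Ry := costRate l p₀ γ W (y, v)) ha.le Λ.2 ?_ ?_
          (hB _ (hcS s) v) hcx (by rwa [norm_sub_rev]) ?_ hδ₂ hδ₃ ?_ ?_
        · simp only [costRate]
          linarith
        · exact (hΛ v).norm_sub_le (hcS s) hy
        · rw [norm_sub_rev]
          have h1 : a * ‖y - x‖ ^ 2 ≤ ε / (2 * Λ + 1) :=
            hay.trans (hWxy.le.trans (min_le_right _ _))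
          rw [le_div_iff₀ (by positivity)] at h1
          have h2 : 0 ≤ a * ‖y - x‖ ^ 2 := by positivity
          linarith
        · have h1 := hmodR (c s, v) ⟨hcS s, mem_univ _⟩ (y, v) ⟨hy, mem_univ _⟩ (by
            rw [Prod.dist_eq, dist_self, max_eq_left dist_nonneg, dist_eq_norm]; linarith)
          rw [Real.dist_eq] at h1
          linarith [le_abs_self (costRate l p₀ γ W (c s, v) - costRate l p₀ γ W (y, v))]
        · have h1 : γ (w / 4) ≤ costRate l p₀ γ W (c s, v) :=
            (hW.γ_strictMono.monotoneOn (show (0 : ℝ) < w / 4 by linarith)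
              (hW.W_pos _ (hSC (hcS s))) (hSW _ (hcS s)).1.le).trans
              (hW.γ_le_costRate hl0 (y := (c s, v)) (hSC (hcS s)))
          have h2 := mul_le_mul_of_nonneg_left h1 hη.le
          rw [hε_def]
          linarith
    have h1 := hφ (left_mem_Icc.mpr hδ.le) ht ht.1
    simp only [φ, intervalIntegral.integral_same, hc0, mul_zero, add_zero] at h1
    have h2 := infConv_le hS hWS a (c t) hy
    rw [norm_sub_rev] at h2
    rw [hVx, norm_sub_rev y x]
    linarith

end RegulatedCost

/-! ### Concatenation of arcs -/

namespace RegulatedCost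

variable {n m : ℕ} {U : Set (EuclideanSpace ℝ (Fin m))}
  {f : EuclideanSpace ℝ (Fin n) × U → EuclideanSpace ℝ (Fin n)}
  {l : EuclideanSpace ℝ (Fin n) × U → ℝ} {C : Set (EuclideanSpace ℝ (Fin n))}
  {p₀ γ : ℝ → ℝ} {W : EuclideanSpace ℝ (Fin n) → ℝ}

/-- A controlled arc on the compact interval `[0, τ]`: a Borel control `u` and a continuous curve
`x` from `z` that satisfies `x' = f(x, u)` off a countable set. Both are defined on the whole line,
but only their restrictions to `[0, τ]` matter. -/
structure IsArc (f : EuclideanSpace ℝ (Fin n) × U → EuclideanSpace ℝ (Fin n))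
    (z : EuclideanSpace ℝ (Fin n)) (τ : ℝ) (u : ℝ → U) (x : ℝ → EuclideanSpace ℝ (Fin n)) :
    Prop where
  nonneg : 0 ≤ τ
  initial : x 0 = z
  measurable : Measurable u
  continuous : Continuous x
  hasDerivAt : ∃ D : Set ℝ, D.Countable ∧ ∀ t ∈ Ioo 0 τ, t ∉ D → HasDerivAt x (f (x t, u t)) t

theorem intervalIntegrable_comp_of_continuousOn {F : Type*} [NormedAddCommGroup F]
    [MeasurableSpace F] [BorelSpace F] [SecondCountableTopology F]
    (hU : IsCompact U) {g : EuclideanSpace ℝ (Fin n) × U → F}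
    {O : Set (EuclideanSpace ℝ (Fin n))} (hO : MeasurableSet O)
    (hg : ContinuousOn g (O ×ˢ univ)) {u : ℝ → U} {x : ℝ → EuclideanSpace ℝ (Fin n)}
    (hu : Measurable u) (hx : Continuous x) {a b : ℝ} (hab : a ≤ b)
    (hxO : ∀ t ∈ Icc a b, x t ∈ O) :
    IntervalIntegrable (fun t => g (x t, u t)) volume a b := by
  classical
  have hUc : CompactSpace U := isCompact_iff_compactSpace.mp hU
  have hmeas : Measurable ((O ×ˢ (univ : Set U)).piecewise g fun _ => 0) :=
    hg.measurable_piecewise continuousOn_const (hO.prod MeasurableSet.univ)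
  have hgm : AEStronglyMeasurable (fun t => g (x t, u t)) (volume.restrict (Icc a b)) := by
    refine ((hmeas.comp (hx.measurable.prodMk hu)).aestronglyMeasurable).congr ?_
    refine (ae_restrict_iff' measurableSet_Icc).mpr (Eventually.of_forall fun t ht => ?_)
    exact piecewise_eq_of_mem _ _ _ ⟨hxO t ht, mem_univ _⟩
  obtain ⟨B, hB⟩ := ((isCompact_Icc (a := a) (b := b)).image hx |>.prod
    (isCompact_univ (X := U))).exists_bound_of_continuousOn (f := g)
    (hg.mono (prod_mono_left (by rintro _ ⟨t, ht, rfl⟩; exact hxO t ht)))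
  rw [intervalIntegrable_iff_integrableOn_Icc_of_le hab]
  refine Integrable.of_bound hgm B ?_
  exact (ae_restrict_iff' measurableSet_Icc).mpr (Eventually.of_forall fun t ht =>
    hB (x t, u t) ⟨⟨t, ht, rfl⟩, mem_univ _⟩)

namespace IsArc

variable {z : EuclideanSpace ℝ (Fin n)} {τ : ℝ} {u : ℝ → U} {x : ℝ → EuclideanSpace ℝ (Fin n)}

theorem absolutelyContinuousOnInterval (h : IsArc f z τ u x) (hU : IsCompact U)
    (hf : Continuous f) : AbsolutelyContinuousOnInterval x 0 τ := by
  have hUc : CompactSpace U := isCompact_iff_compactSpace.mp hU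
  obtain ⟨D, hD, hder⟩ := h.hasDerivAt
  obtain ⟨B, hB⟩ := ((isCompact_Icc (a := 0) (b := τ)).image h.continuous |>.prod
    (isCompact_univ (X := U))).exists_bound_of_continuousOn hf.continuousOn
  have hint : ∀ a b, a ≤ b → IntervalIntegrable (fun t => f (x t, u t)) volume a b :=
    fun a b hab => intervalIntegrable_comp_of_continuousOn hU MeasurableSet.univ hf.continuousOn
      h.measurable h.continuous hab fun _ _ => mem_univ _
  have key : ∀ a b, 0 ≤ a → a ≤ b → b ≤ τ → dist (x a) (x b) ≤ B.toNNReal * dist a b := by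
    intro a b ha hab hb
    have hftc := integral_eq_of_hasDerivAt_off_countable_of_le x (fun t => f (x t, u t)) hab hD
      h.continuous.continuousOn
      (fun t ht => hder t ⟨ha.trans_lt ht.1.1, ht.1.2.trans_le hb⟩ ht.2) (hint a b hab)
    rw [dist_comm, dist_eq_norm, ← hftc, dist_comm, Real.dist_eq]
    refine intervalIntegral.norm_integral_le_of_norm_le_const fun t ht => ?_
    rw [uIoc_of_le hab] at ht
    exact (hB (x t, u t) ⟨⟨t, ⟨ha.trans ht.1.le, ht.2.trans hb⟩, rfl⟩, mem_univ _⟩).trans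
      (Real.le_coe_toNNReal B)
  refine LipschitzOnWith.absolutelyContinuousOnInterval (K := B.toNNReal)
    (LipschitzOnWith.of_dist_le_mul ?_)
  rw [uIcc_of_le h.nonneg]
  intro a ha b hb
  rcases le_total a b with hab | hab
  · exact key a b ha.1 hab hb.2
  · rw [dist_comm, dist_comm a]
    exact key b a hb.1 hab ha.2

end IsArc

/-- The cost `∫₀ᵀ p₀(W(x)) l(x,u) + γ(W(x))` of the curve `x` with control `u`. -/
noncomputable def pathCost (l : EuclideanSpace ℝ (Fin n) × U → ℝ) (p₀ γ : ℝ → ℝ)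
    (W : EuclideanSpace ℝ (Fin n) → ℝ) (x : ℝ → EuclideanSpace ℝ (Fin n)) (u : ℝ → U)
    (T : ℝ) : ℝ :=
  ∫ t in (0 : ℝ)..T, costRate l p₀ γ W (x t, u t)

theorem pathCost_congr {x x' : ℝ → EuclideanSpace ℝ (Fin n)} {u u' : ℝ → U} {T : ℝ} (hT : 0 ≤ T)
    (hx : EqOn x x' (Icc 0 T)) (hu : EqOn u u' (Icc 0 T)) :
    pathCost l p₀ γ W x u T = pathCost l p₀ γ W x' u' T := by
  refine intervalIntegral.integral_congr fun t ht => ?_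
  rw [uIcc_of_le hT] at ht
  simp only [hx ht, hu ht]

theorem IsMRF.pathCost_nonneg (hW : IsMRF f l C p₀ γ W) (hl0 : ∀ y, 0 ≤ l y)
    {x : ℝ → EuclideanSpace ℝ (Fin n)} {u : ℝ → U} {T : ℝ} (hT : 0 ≤ T)
    (hx : ∀ t ∈ Icc 0 T, x t ∉ C) : 0 ≤ pathCost l p₀ γ W x u T :=
  intervalIntegral.integral_nonneg hT fun t ht => (hW.costRate_pos hl0 (hx t ht)).le

/-- Concatenation at time `τ`: follow `a` up to time `τ`, then `b`, started at time `τ`. -/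
noncomputable def concat {X : Type*} (τ : ℝ) (a b : ℝ → X) (t : ℝ) : X :=
  if t ≤ τ then a t else b (t - τ)

theorem concat_of_le {X : Type*} {τ t : ℝ} (a b : ℝ → X) (h : t ≤ τ) : concat τ a b t = a t :=
  if_pos h

theorem concat_of_lt {X : Type*} {τ t : ℝ} (a b : ℝ → X) (h : τ < t) :
    concat τ a b t = b (t - τ) :=
  if_neg h.not_ge

theorem concat_of_ge {X : Type*} {τ t : ℝ} {a b : ℝ → X} (hab : a τ = b 0) (h : τ ≤ t) :
    concat τ a b t = b (t - τ) := by
  rcases h.eq_or_lt with rfl | h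
  · rw [concat_of_le a b le_rfl, hab, sub_self]
  · exact concat_of_lt a b h

section Concat

variable {z : EuclideanSpace ℝ (Fin n)} {τ₁ τ₂ : ℝ} {u₁ u₂ : ℝ → U}
  {x₁ x₂ : ℝ → EuclideanSpace ℝ (Fin n)}

theorem IsArc.concat (h₁ : IsArc f z τ₁ u₁ x₁) (h₂ : IsArc f (x₁ τ₁) τ₂ u₂ x₂) :
    IsArc f z (τ₁ + τ₂) (concat τ₁ u₁ u₂) (concat τ₁ x₁ x₂) := by
  obtain ⟨D₁, hD₁, hd₁⟩ := h₁.hasDerivAt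
  obtain ⟨D₂, hD₂, hd₂⟩ := h₂.hasDerivAt
  refine ⟨add_nonneg h₁.nonneg h₂.nonneg, ?_, ?_, ?_, ?_⟩
  · rw [concat_of_le _ _ h₁.nonneg, h₁.initial]
  · exact Measurable.ite measurableSet_Iic h₁.measurable
      (h₂.measurable.comp (measurable_id.sub_const τ₁))
  · refine Continuous.if_le h₁.continuous (h₂.continuous.comp (by fun_prop)) continuous_id
      continuous_const fun t ht => ?_
    rw [show t = τ₁ from ht, sub_self, h₂.initial]
  · refine ⟨D₁ ∪ {τ₁} ∪ (fun t => t + τ₁) '' D₂,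
      (hD₁.union (countable_singleton _)).union (hD₂.image _), fun t ht htD => ?_⟩
    rcases lt_trichotomy t τ₁ with hlt | heq | hgt
    · rw [concat_of_le _ _ hlt.le, concat_of_le _ _ hlt.le]
      refine (hd₁ t ⟨ht.1, hlt⟩ fun h => htD (Or.inl (Or.inl h))).congr_of_eventuallyEq ?_
      filter_upwards [gt_mem_nhds hlt] with s hs
      exact concat_of_le _ _ hs.le
    · exact absurd (Or.inl (Or.inr heq)) htD
    · rw [concat_of_lt _ _ hgt, concat_of_lt _ _ hgt]
      have hd := hd₂ (t - τ₁) ⟨by linarith, by linarith [ht.2]⟩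
        fun h => htD (Or.inr ⟨_, h, sub_add_cancel _ _⟩)
      refine (hd.comp_sub_const t τ₁).congr_of_eventuallyEq ?_
      filter_upwards [lt_mem_nhds hgt] with s hs
      exact concat_of_lt _ _ hs

theorem IsMRF.intervalIntegrable_costRate (hW : IsMRF f l C p₀ γ W) (hU : IsCompact U)
    (hC : IsClosed C) (hl : Continuous l) (h₁ : IsArc f z τ₁ u₁ x₁)
    (hx₁ : ∀ t ∈ Icc 0 τ₁, x₁ t ∉ C) {T : ℝ} (hT : 0 ≤ T) (hTτ : T ≤ τ₁) :
    IntervalIntegrable (fun t => costRate l p₀ γ W (x₁ t, u₁ t)) volume 0 T :=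
  intervalIntegrable_comp_of_continuousOn hU hC.measurableSet.compl (hW.continuousOn_costRate hl)
    h₁.measurable h₁.continuous hT fun t ht => hx₁ t ⟨ht.1, ht.2.trans hTτ⟩

theorem IsMRF.pathCost_concat (hW : IsMRF f l C p₀ γ W) (hU : IsCompact U)
    (hC : IsClosed C) (hl : Continuous l) (h₁ : IsArc f z τ₁ u₁ x₁)
    (h₂ : IsArc f (x₁ τ₁) τ₂ u₂ x₂) (hx₁ : ∀ t ∈ Icc 0 τ₁, x₁ t ∉ C)
    (hx₂ : ∀ t ∈ Icc 0 τ₂, x₂ t ∉ C) {t : ℝ} (ht : τ₁ ≤ t) (htτ : t ≤ τ₁ + τ₂) :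
    pathCost l p₀ γ W (concat τ₁ x₁ x₂) (concat τ₁ u₁ u₂) t =
      pathCost l p₀ γ W x₁ u₁ τ₁ + pathCost l p₀ γ W x₂ u₂ (t - τ₁) := by
  have hx : ∀ s ∈ Icc 0 (τ₁ + τ₂), RegulatedCost.concat τ₁ x₁ x₂ s ∉ C := by
    intro s hs
    rcases le_or_gt s τ₁ with h | h
    · rw [concat_of_le _ _ h]
      exact hx₁ s ⟨hs.1, h⟩
    · rw [concat_of_lt _ _ h]
      exact hx₂ _ ⟨by linarith, by linarith [hs.2]⟩
  have hint := hW.intervalIntegrable_costRate hU hC hl (h₁.concat h₂) hx (h₁.nonneg.trans ht) htτ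
  have hint₁ := hW.intervalIntegrable_costRate hU hC hl (h₁.concat h₂) hx h₁.nonneg
    (le_add_of_nonneg_right h₂.nonneg)
  have e : pathCost l p₀ γ W x₂ u₂ (t - τ₁) = ∫ s in τ₁..t,
      costRate l p₀ γ W (x₂ (s - τ₁), u₂ (s - τ₁)) := by
    rw [intervalIntegral.integral_comp_sub_right
      (fun s => costRate l p₀ γ W (x₂ s, u₂ s)) τ₁, sub_self, pathCost]
  rw [e, pathCost, ← intervalIntegral.integral_add_adjacent_intervals hint₁
    (hint₁.symm.trans hint)]
  congr 1
  · exact pathCost_congr h₁.nonneg (fun s hs => concat_of_le _ _ hs.2)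
      fun s hs => concat_of_le _ _ hs.2
  · refine intervalIntegral.integral_congr_ae (Eventually.of_forall fun s hs => ?_)
    rw [uIoc_of_le ht] at hs
    simp only [concat_of_lt _ _ hs.1]

/-- To check a property of position and accumulated cost along a concatenation, it suffices to
check it along both parts. -/
theorem IsMRF.forall_concat (hW : IsMRF f l C p₀ γ W) (hU : IsCompact U)
    (hC : IsClosed C) (hl : Continuous l) (h₁ : IsArc f z τ₁ u₁ x₁)
    (h₂ : IsArc f (x₁ τ₁) τ₂ u₂ x₂) (hx₁ : ∀ t ∈ Icc 0 τ₁, x₁ t ∉ C)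
    (hx₂ : ∀ t ∈ Icc 0 τ₂, x₂ t ∉ C) {P : EuclideanSpace ℝ (Fin n) → ℝ → Prop}
    (hP₁ : ∀ t ∈ Icc 0 τ₁, P (x₁ t) (pathCost l p₀ γ W x₁ u₁ t))
    (hP₂ : ∀ t ∈ Icc 0 τ₂,
      P (x₂ t) (pathCost l p₀ γ W x₁ u₁ τ₁ + pathCost l p₀ γ W x₂ u₂ t)) :
    ∀ t ∈ Icc 0 (τ₁ + τ₂), P (concat τ₁ x₁ x₂ t)
      (pathCost l p₀ γ W (concat τ₁ x₁ x₂) (concat τ₁ u₁ u₂) t) := by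
  intro t ht
  rcases le_or_gt t τ₁ with h | h
  · rw [concat_of_le _ _ h, pathCost_congr ht.1 (fun s hs => concat_of_le _ _ (hs.2.trans h))
      fun s hs => concat_of_le _ _ (hs.2.trans h)]
    exact hP₁ t ⟨ht.1, h⟩
  · rw [hW.pathCost_concat hU hC hl h₁ h₂ hx₁ hx₂ h.le ht.2, concat_of_lt _ _ h]
    exact hP₂ _ ⟨by linarith, by linarith [ht.2]⟩

end Concat

/-- Finitely many descent steps halve `W`, while `W` plus the accumulated cost grows by at most
`ε`. -/
theorem IsMRF.exists_arc_halving (hW : IsMRF f l C p₀ γ W) (hU : IsCompact U) (hU' : U.Nonempty)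
    (hC : IsClosed C) (hf : Continuous f) (hfL : LocLipUnif f) (hl : Continuous l)
    (hl0 : ∀ y, 0 ≤ l y) {z : EuclideanSpace ℝ (Fin n)} (hz : z ∉ C) {ε : ℝ} (hε : 0 < ε) :
    ∃ (τ : ℝ) (u : ℝ → U) (x : ℝ → EuclideanSpace ℝ (Fin n)), IsArc f z τ u x ∧
      W (x τ) ≤ W z / 2 ∧
      ∀ t ∈ Icc 0 τ, x t ∉ C ∧ W (x t) + pathCost l p₀ γ W x u t ≤ W z + ε := by
  obtain ⟨w, hw_def⟩ : ∃ w, w = W z := ⟨_, rfl⟩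
  have hw : 0 < w := hw_def ▸ hW.W_pos z hz
  -- The cost of the whole arc is at most `4w`, so giving away the fraction `η` of it costs at
  -- most `ε / 2`; the other half of `ε` pays for the error `ω` of the approximation of `W`.
  obtain ⟨η, hη, hη₁, hη₂⟩ : ∃ η : ℝ, 0 < η ∧ η ≤ 1 / 2 ∧ η * (4 * w) ≤ ε / 2 := by
    refine ⟨min (1 / 2) (ε / (8 * w)), by positivity, min_le_left _ _, ?_⟩
    calc min (1 / 2) (ε / (8 * w)) * (4 * w) ≤ ε / (8 * w) * (4 * w) := by
          gcongr; exact min_le_right _ _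
      _ = ε / 2 := by field_simp; norm_num
  obtain ⟨ω, hω, hω₁, hω₂⟩ : ∃ ω : ℝ, 0 < ω ∧ ω ≤ ε / 2 ∧ ω ≤ w / 4 :=
    ⟨min (ε / 2) (w / 4), by positivity, min_le_left _ _, min_le_right _ _⟩
  obtain ⟨V, δ, hδ, hstep⟩ :=
    hW.exists_descent_step hU hU' hC hf hfL hl hl0 hw hη hω
  have hγ : 0 < γ (w / 4) := hW.γ_pos _ (by linarith)
  have main : ∀ N : ℕ, ∀ y, y ∉ C → w / 2 ≤ W y → W y ≤ V y + ω → V y ≤ w →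
      V y ≤ N * ((1 - η) * (γ (w / 4) * δ)) →
      ∃ (τ : ℝ) (u : ℝ → U) (x : ℝ → EuclideanSpace ℝ (Fin n)), IsArc f y τ u x ∧
        W (x τ) ≤ w / 2 ∧ ∀ t ∈ Icc 0 τ, x t ∉ C ∧ W (x t) ≤ V (x t) + ω ∧
          V (x t) + (1 - η) * pathCost l p₀ γ W x u t ≤ V y := by
    intro N
    induction N with
    | zero =>
      intro y hy hy1 hy2 hy3 hy4
      rw [Nat.cast_zero, zero_mul] at hy4
      linarith
    | succ N ih =>
      intro y hy hy1 hy2 hy3 hy4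
      obtain ⟨-, v, c, hc, hc0, hcd, hct⟩ := hstep y hy hy1 (by linarith)
      have harc : IsArc f y δ (fun _ => v) c :=
        ⟨hδ.le, hc0, measurable_const, hc, ∅, countable_empty, fun t ht _ => hcd t ht⟩
      have hend := hct δ (right_mem_Icc.mpr hδ.le)
      by_cases hhalf : W (c δ) ≤ w / 2
      · exact ⟨δ, _, c, harc, hhalf, fun t ht =>
          ⟨(hct t ht).1, (hct t ht).2.2.1, (hct t ht).2.2.2⟩⟩
      · have hcost : γ (w / 4) * δ ≤ pathCost l p₀ γ W c (fun _ => v) δ := by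
          have hmono : ∀ t ∈ Icc 0 δ, γ (w / 4) ≤ costRate l p₀ γ W (c t, v) := fun t ht =>
            (hW.γ_strictMono.monotoneOn (show (0 : ℝ) < w / 4 by linarith)
              (hW.W_pos _ (hct t ht).1) (hct t ht).2.1).trans
              (hW.γ_le_costRate hl0 (y := (c t, v)) (hct t ht).1)
          have := intervalIntegral.integral_mono_on hδ.le intervalIntegrable_const
            (hW.intervalIntegrable_costRate hU hC hl harc (fun t ht => (hct t ht).1) hδ.le le_rfl)
            hmono
          rw [intervalIntegral.integral_const, smul_eq_mul, sub_zero] at this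
          rw [mul_comm]
          exact this
        have hcost' : (1 - η) * (γ (w / 4) * δ) ≤
            (1 - η) * pathCost l p₀ γ W c (fun _ => v) δ := by
          gcongr
          linarith
        have hdec : V (c δ) + (1 - η) * pathCost l p₀ γ W c (fun _ => v) δ ≤ V y := hend.2.2.2
        have hpos : 0 ≤ (1 - η) * (γ (w / 4) * δ) :=
          mul_nonneg (by linarith) (by positivity)
        obtain ⟨τ, u, x, hx, hxτ, hxt⟩ := ih (c δ) hend.1 (not_le.mp hhalf).le hend.2.2.1
          (by linarith) (by push_cast at hy4; linarith)
        refine ⟨δ + τ, _, _, harc.concat hx, ?_, hW.forall_concat hU hC hl harc hx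
          (fun t ht => (hct t ht).1) (fun t ht => (hxt t ht).1)
          (P := fun X J => X ∉ C ∧ W X ≤ V X + ω ∧ V X + (1 - η) * J ≤ V y)
          (fun t ht => ⟨(hct t ht).1, (hct t ht).2.2.1, (hct t ht).2.2.2⟩) fun t ht =>
            ⟨(hxt t ht).1, (hxt t ht).2.1, ?_⟩⟩
        · rw [concat_of_ge hx.initial.symm (le_add_of_nonneg_right hx.nonneg),
            add_sub_cancel_left]
          exact hxτ
        · have := (hxt t ht).2.2
          rw [mul_add]
          linarith
  obtain ⟨hVz, v, c, -, hc0, -, hct⟩ := hstep z hz (by linarith) (by linarith)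
  have h0 := (hct 0 (left_mem_Icc.mpr hδ.le)).2.2.1
  rw [hc0] at h0
  obtain ⟨N, hN⟩ := Archimedean.arch (V z)
    (show 0 < (1 - η) * (γ (w / 4) * δ) from mul_pos (by linarith) (by positivity))
  rw [nsmul_eq_mul] at hN
  obtain ⟨τ, u, x, hx, hxτ, hxt⟩ := main N z hz (by linarith) h0 (by linarith) hN
  refine ⟨τ, u, x, hx, by linarith, fun t ht => ⟨(hxt t ht).1, ?_⟩⟩
  obtain ⟨hxC, hxV, hxd⟩ := hxt t ht
  have hJ : 0 ≤ pathCost l p₀ γ W x u t := hW.pathCost_nonneg hl0 ht.1 fun s hs =>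
    (hxt s ⟨hs.1, hs.2.trans ht.2⟩).1
  have hWx := hW.W_pos _ hxC
  have hJ4 : pathCost l p₀ γ W x u t ≤ 4 * w := by
    have : 1 / 2 * pathCost l p₀ γ W x u t ≤ (1 - η) * pathCost l p₀ γ W x u t := by
      gcongr
      linarith
    linarith
  have hηJ : η * pathCost l p₀ γ W x u t ≤ η * (4 * w) := by gcongr
  linarith

end RegulatedCost

/-! ### The infinite concatenation -/

namespace RegulatedCost

variable {n m : ℕ} {U : Set (EuclideanSpace ℝ (Fin m))}
  {f : EuclideanSpace ℝ (Fin n) × U → EuclideanSpace ℝ (Fin n)}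
  {l : EuclideanSpace ℝ (Fin n) × U → ℝ} {C : Set (EuclideanSpace ℝ (Fin n))}
  {p₀ γ : ℝ → ℝ} {W : EuclideanSpace ℝ (Fin n) → ℝ}

/-- Outside the target, small values of `W` force a small distance from the target. -/
theorem IsMRF.exists_infDist_lt (hW : IsMRF f l C p₀ γ W) {e : ℝ} (he : 0 < e) :
    ∃ d : ℝ, 0 < d ∧ ∀ x, x ∉ C → W x < d → Metric.infDist x C < e := by
  have hK := hW.W_proper (Icc 0 1) (fun t ht => ht.1) isCompact_Icc
  have hKe : IsCompact ((closure Cᶜ ∩ W ⁻¹' Icc 0 1) ∩ {x | e ≤ Metric.infDist x C}) :=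
    hK.inter_right (isClosed_le continuous_const (Metric.continuous_infDist_pt C))
  have hout : ∀ x, e ≤ Metric.infDist x C → x ∉ C := fun x hx hxC => by
    rw [Metric.infDist_zero_of_mem hxC] at hx
    linarith
  rcases ((closure Cᶜ ∩ W ⁻¹' Icc 0 1) ∩ {x | e ≤ Metric.infDist x C}).eq_empty_or_nonempty
    with hemp | hne
  · refine ⟨1, one_pos, fun x hx hxd => ?_⟩
    by_contra! hcon
    exact hemp.subset ⟨⟨subset_closure hx, (hW.W_pos x hx).le, hxd.le⟩, hcon⟩
  · obtain ⟨y, hy, hmin⟩ := hKe.exists_isMinOn hne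
      (hW.W_cont.mono (inter_subset_left.trans inter_subset_left))
    refine ⟨min 1 (W y), lt_min one_pos (hW.W_pos y (hout y hy.2)), fun x hx hxd => ?_⟩
    by_contra! hcon
    have := hmin ⟨⟨subset_closure hx, (hW.W_pos x hx).le, (hxd.trans_le (min_le_left _ _)).le⟩,
      hcon⟩
    exact absurd (hxd.trans_le (min_le_right _ _)) (not_lt.mpr this)

/-- An infinite sequence of arcs, each extending the previous one, along which `W` tends to `0`
while `W` plus the accumulated cost stays below `W z + ε`. -/
theorem IsMRF.exists_arc_sequence (hW : IsMRF f l C p₀ γ W) (hU : IsCompact U) (hU' : U.Nonempty)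
    (hC : IsClosed C) (hf : Continuous f) (hfL : LocLipUnif f) (hl : Continuous l)
    (hl0 : ∀ y, 0 ≤ l y) {z : EuclideanSpace ℝ (Fin n)} (hz : z ∉ C) {ε : ℝ} (hε : 0 < ε) :
    ∃ (τ : ℕ → ℝ) (u : ℕ → ℝ → U) (x : ℕ → ℝ → EuclideanSpace ℝ (Fin n)),
      (∀ k, IsArc f z (τ k) (u k) (x k)) ∧
      (∀ k, ∀ t ∈ Icc 0 (τ k), x k t ∉ C ∧
        W (x k t) + pathCost l p₀ γ W (x k) (u k) t ≤ W z + ε) ∧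
      (∀ k, τ k < τ (k + 1)) ∧
      (∀ k, EqOn (u (k + 1)) (u k) (Iic (τ k))) ∧
      (∀ k, EqOn (x (k + 1)) (x k) (Iic (τ k))) ∧
      ∀ k, ∀ t ∈ Icc (τ k) (τ (k + 1)), W (x (k + 1) t) ≤ (W z + ε) * (1 / 2) ^ k := by
  let Q : ℕ → ℝ × (ℝ → U) × (ℝ → EuclideanSpace ℝ (Fin n)) → Prop := fun k s =>
    IsArc f z s.1 s.2.1 s.2.2 ∧ W (s.2.2 s.1) ≤ W z * (1 / 2) ^ k ∧
      ∀ t ∈ Icc 0 s.1, s.2.2 t ∉ C ∧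
        W (s.2.2 t) + pathCost l p₀ γ W s.2.2 s.2.1 t ≤ W z + ε * (1 - (1 / 2) ^ k)
  have hnext : ∀ k s, Q k s → ∃ s', Q (k + 1) s' ∧ s.1 < s'.1 ∧
      EqOn s'.2.1 s.2.1 (Iic s.1) ∧ EqOn s'.2.2 s.2.2 (Iic s.1) ∧
      ∀ t ∈ Icc s.1 s'.1, W (s'.2.2 t) ≤ (W z + ε) * (1 / 2) ^ k := by
    rintro k ⟨τ₁, u₁, x₁⟩ ⟨h₁, hend₁, hx₁⟩
    simp only at h₁ hend₁ hx₁
    have h2k : (0 : ℝ) < (1 / 2) ^ k := by positivity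
    have hτ₁ := hx₁ τ₁ (right_mem_Icc.mpr h₁.nonneg)
    obtain ⟨τ₂, u₂, x₂, h₂, hend₂, hx₂⟩ :=
      hW.exists_arc_halving hU hU' hC hf hfL hl hl0 hτ₁.1 (ε := ε * (1 / 2) ^ (k + 1))
        (by positivity)
    have hτ₂ : 0 < τ₂ := by
      refine h₂.nonneg.lt_of_ne fun h => ?_
      rw [← h, h₂.initial] at hend₂
      linarith [hW.W_pos _ hτ₁.1]
    have hsucc : ((1 : ℝ) / 2) ^ (k + 1) = (1 / 2) ^ k / 2 := by rw [pow_succ]; ring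
    rw [hsucc] at hx₂
    refine ⟨⟨τ₁ + τ₂, concat τ₁ u₁ u₂, concat τ₁ x₁ x₂⟩, ⟨h₁.concat h₂, ?_, ?_⟩,
      lt_add_of_pos_right _ hτ₂, fun t ht => concat_of_le _ _ ht, fun t ht => concat_of_le _ _ ht,
      fun t ht => ?_⟩
    · simp only
      rw [concat_of_ge h₂.initial.symm (le_add_of_nonneg_right h₂.nonneg), add_sub_cancel_left,
        hsucc]
      linarith
    · refine hW.forall_concat hU hC hl h₁ h₂ (fun t ht => (hx₁ t ht).1) (fun t ht => (hx₂ t ht).1)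
        (P := fun X J => X ∉ C ∧ W X + J ≤ W z + ε * (1 - (1 / 2) ^ (k + 1)))
        (fun t ht => ⟨(hx₁ t ht).1, ?_⟩) fun t ht => ⟨(hx₂ t ht).1, ?_⟩
      · have := (hx₁ t ht).2
        rw [hsucc]
        nlinarith
      · have h3 := (hx₂ t ht).2
        have h4 := hτ₁.2
        rw [hsucc]
        linarith
    · simp only at ht ⊢
      rw [concat_of_ge h₂.initial.symm ht.1]
      have hmem : t - τ₁ ∈ Icc 0 τ₂ := ⟨by linarith [ht.1], by linarith [ht.2]⟩
      have h3 := (hx₂ _ hmem).2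
      have h4 : 0 ≤ pathCost l p₀ γ W x₂ u₂ (t - τ₁) := hW.pathCost_nonneg hl0 hmem.1
        fun s hs => (hx₂ s ⟨hs.1, hs.2.trans hmem.2⟩).1
      have h5 : 0 < ε * (1 / 2) ^ k := by positivity
      linarith
  obtain ⟨u₀⟩ := hU'.to_subtype
  have hQ0 : Q 0 ⟨0, fun _ => u₀, fun _ => z⟩ := by
    refine ⟨⟨le_rfl, rfl, measurable_const, continuous_const, ∅, countable_empty,
      fun t ht => absurd ht.1 ht.2.not_gt⟩, by simp, fun t ht => ⟨hz, ?_⟩⟩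
    rw [show t = 0 from le_antisymm ht.2 ht.1]
    simp [pathCost]
  choose! F hF using hnext
  let s : ℕ → ℝ × (ℝ → U) × (ℝ → EuclideanSpace ℝ (Fin n)) := fun k =>
    Nat.rec ⟨0, fun _ => u₀, fun _ => z⟩ (fun k s => F k s) k
  have hQ : ∀ k, Q k (s k) := fun k => by
    induction k with
    | zero => exact hQ0
    | succ k ih => exact (hF k (s k) ih).1
  have hR := fun k => (hF k (s k) (hQ k)).2
  refine ⟨fun k => (s k).1, fun k => (s k).2.1, fun k => (s k).2.2, fun k => (hQ k).1,
    fun k t ht => ⟨((hQ k).2.2 t ht).1, ((hQ k).2.2 t ht).2.trans ?_⟩, fun k => (hR k).1,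
    fun k => (hR k).2.1, fun k => (hR k).2.2.1, fun k => (hR k).2.2.2⟩
  have : (0 : ℝ) < ε * (1 / 2) ^ k := by positivity
  linarith

theorem eqOn_of_eqOn_succ {X : Type*} {τ : ℕ → ℝ} {a : ℕ → ℝ → X} (hτ : Monotone τ)
    (ha : ∀ k, EqOn (a (k + 1)) (a k) (Iic (τ k))) :
    Pairwise fun i j => EqOn (a i) (a j) (Iic (τ i) ∩ Iic (τ j)) := by
  have key : ∀ i j, i ≤ j → EqOn (a j) (a i) (Iic (τ i)) := by
    intro i j hij
    induction j, hij using Nat.le_induction with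
    | base => exact fun _ _ => rfl
    | succ j hij ih =>
      exact fun t ht => (ha j ((mem_Iic.mp ht).trans (hτ hij))).trans (ih ht)
  intro i j _ t ht
  rcases le_total i j with h | h
  · exact (key i j h ht.1).symm
  · exact key j i h ht.2

/-- The union of a sequence of arcs extending one another is a solution up to the supremum of
their end times. -/
theorem isSolutionOn_iSup (hU : IsCompact U) (hf : Continuous f)
    {z : EuclideanSpace ℝ (Fin n)} {τ : ℕ → ℝ} {u : ℕ → ℝ → U}
    {x : ℕ → ℝ → EuclideanSpace ℝ (Fin n)} (h : ∀ k, IsArc f z (τ k) (u k) (x k))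
    {u' : ℝ → U} {x' : ℝ → EuclideanSpace ℝ (Fin n)} (hu : ∀ k, EqOn u' (u k) (Iic (τ k)))
    (hx : ∀ k, EqOn x' (x k) (Iic (τ k))) :
    IsSolutionOn f z u' (⨆ k, (τ k : EReal)) x' := by
  have hex : ∀ t : ℝ, (t : EReal) < ⨆ k, (τ k : EReal) → ∃ k, t < τ k := fun t ht => by
    obtain ⟨k, hk⟩ := lt_iSup_iff.mp ht
    exact ⟨k, EReal.coe_lt_coe_iff.mp hk⟩
  choose D hD hder using fun k => (h k).hasDerivAt
  refine ⟨?_, fun t ht htτ => ?_, ?_⟩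
  · rw [hx 0 (h 0).nonneg, (h 0).initial]
  · obtain ⟨k, hk⟩ := hex t htτ
    refine (((h k).absolutelyContinuousOnInterval hU hf).mono ?_).congr_of_eqOn fun s hs => ?_
    · rw [uIcc_of_le ht, uIcc_of_le (h k).nonneg]
      exact Icc_subset_Icc_right hk.le
    · rw [uIcc_of_le ht] at hs
      exact (hx k (hs.2.trans hk.le)).symm
  · filter_upwards [(countable_iUnion hD).ae_notMem volume] with t htD ht0 htτ
    obtain ⟨k, hk⟩ := hex t htτ
    rw [hx k hk.le, hu k hk.le]
    refine (hder k t ⟨ht0, hk⟩ fun hmem => htD (mem_iUnion.mpr ⟨k, hmem⟩)).congr_of_eventuallyEq ?_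
    filter_upwards [gt_mem_nhds hk] with s hs
    exact hx k (le_of_lt hs)

/-- For every `ε > 0` some admissible control keeps the value of `W` plus the accumulated cost
below `W z + ε`, up to its target time. -/
theorem IsMRF.exists_admissible_control (hW : IsMRF f l C p₀ γ W) (hU : IsCompact U)
    (hU' : U.Nonempty) (hC : IsClosed C) (hC' : C.Nonempty) (hf : Continuous f)
    (hfL : LocLipUnif f) (hl : Continuous l) (hl0 : ∀ y, 0 ≤ l y)
    {z : EuclideanSpace ℝ (Fin n)} (hz : z ∉ C) {ε : ℝ} (hε : 0 < ε) :
    ∃ u ∈ admissibleControls f C z, ∀ T : ℝ, 0 ≤ T → (T : EReal) < targetTime f C z u →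
      pathCost l p₀ γ W (trajectory f z u) u T + W (trajectory f z u T) ≤ W z + ε := by
  obtain ⟨τ, u, x, harc, hbound, hlt, hu, hx, hdecay⟩ :=
    hW.exists_arc_sequence hU hU' hC hf hfL hl hl0 hz hε
  have hmono : StrictMono τ := strictMono_nat_of_lt_succ hlt
  obtain ⟨u', hu'm, hu'⟩ := exists_measurable_piecewise (fun k => Iic (τ k))
    (fun _ => measurableSet_Iic) u (fun k => (harc k).measurable)
    (eqOn_of_eqOn_succ hmono.monotone hu)
  obtain ⟨x', -, hx'⟩ := exists_measurable_piecewise (fun k => Iic (τ k))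
    (fun _ => measurableSet_Iic) x (fun k => (harc k).continuous.measurable)
    (eqOn_of_eqOn_succ hmono.monotone hx)
  have hsol := isSolutionOn_iSup hU hf harc hu' hx'
  have hex : ∀ t : ℝ, (t : EReal) < ⨆ k, (τ k : EReal) → ∃ k, t < τ k := fun t ht => by
    obtain ⟨k, hk⟩ := lt_iSup_iff.mp ht
    exact ⟨k, EReal.coe_lt_coe_iff.mp hk⟩
  have hτT : ∀ k, (τ k : EReal) < ⨆ k, (τ k : EReal) := fun k =>
    (EReal.coe_lt_coe_iff.mpr (hlt k)).trans_le (le_iSup (fun k => (τ k : EReal)) (k + 1))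
  have htraj : ∀ k, ∀ t ∈ Icc 0 (τ k), trajectory f z u' t = x k t := fun k t ht =>
    (hsol.trajectory_eq hU hf hfL ht.1 ((EReal.coe_le_coe_iff.mpr ht.2).trans_lt (hτT k))).trans
      (hx' k ht.2)
  have hnotMem : ∀ t : ℝ, 0 ≤ t → (t : EReal) < ⨆ k, (τ k : EReal) →
      trajectory f z u' t ∉ C := fun t ht htT => by
    obtain ⟨k, hk⟩ := hex t htT
    rw [htraj k t ⟨ht, hk.le⟩]
    exact (hbound k t ⟨ht, hk.le⟩).1
  have hsmall : ∀ k N, ∀ t, τ k ≤ t → t < τ N →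
      W (trajectory f z u' t) ≤ (W z + ε) * (1 / 2) ^ k := by
    intro k N t hkt
    induction N with
    | zero => exact fun h => absurd (hmono.monotone (Nat.zero_le k)) (hkt.trans_lt h).not_ge
    | succ N ih =>
      intro htN
      rcases lt_or_ge t (τ N) with h | h
      · exact ih h
      · rw [htraj (N + 1) t ⟨(harc N).nonneg.trans h, htN.le⟩]
        have hkN : k ≤ N := Nat.lt_succ_iff.mp (hmono.lt_iff_lt.mp (hkt.trans_lt htN))
        refine (hdecay N t ⟨h, htN.le⟩).trans ?_
        have := hW.W_pos z hz
        exact mul_le_mul_of_nonneg_left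
          (pow_le_pow_of_le_one (by norm_num) (by norm_num) hkN) (by linarith)
  have htarget : IsTargetTime f C z u' (⨆ k, (τ k : EReal)) := by
    refine ⟨?_, hsol.le_maxTime, hnotMem, fun T hT => ?_⟩
    · exact (EReal.coe_le_coe_iff.mpr (harc 0).nonneg).trans_lt (hτT 0)
    · rw [Metric.tendsto_nhds]
      intro e he
      obtain ⟨d, hd, hWd⟩ := hW.exists_infDist_lt he
      have hlim : Tendsto (fun k : ℕ => (W z + ε) * (1 / 2 : ℝ) ^ k) atTop (𝓝 0) := by
        simpa using (tendsto_pow_atTop_nhds_zero_of_lt_one (by norm_num : (0 : ℝ) ≤ 1 / 2)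
          (by norm_num)).const_mul (W z + ε)
      obtain ⟨k, hk⟩ := (hlim.eventually (gt_mem_nhds hd)).exists
      have hkT : τ k < T := EReal.coe_lt_coe_iff.mp (hT ▸ hτT k)
      filter_upwards [Ico_mem_nhdsLT hkT] with t ht
      have htT : (t : EReal) < ⨆ k, (τ k : EReal) := hT ▸ EReal.coe_lt_coe_iff.mpr ht.2
      obtain ⟨N, hN⟩ := hex t htT
      rw [Real.dist_eq, sub_zero, abs_of_nonneg Metric.infDist_nonneg]
      exact hWd _ (hnotMem t ((harc k).nonneg.trans ht.1) htT)
        ((hsmall k N t ht.1 hN).trans_lt hk)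
  refine ⟨u', ⟨hu'm.aemeasurable, _, htarget⟩, fun T hT hTlt => ?_⟩
  rw [htarget.targetTime_eq hU hf hfL hC hC'] at hTlt
  obtain ⟨k, hk⟩ := hex T hTlt
  rw [pathCost_congr (x' := x k) (u' := u k) hT
    (fun t ht => htraj k t ⟨ht.1, ht.2.trans hk.le⟩) fun t ht => hu' k (ht.2.trans hk.le),
    htraj k T ⟨hT, hk.le⟩, add_comm]
  exact (hbound k T ⟨hT, hk.le⟩).2

end RegulatedCost

theorem proposition4p1 {n m : ℕ}
    (U : Set (EuclideanSpace ℝ (Fin m))) (hU : IsCompact U) (hU' : U.Nonempty)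
    (C : Set (EuclideanSpace ℝ (Fin n))) (hC : IsClosed C) (hC' : C.Nonempty)
    (hCb : IsCompact (frontier C))
    (f : EuclideanSpace ℝ (Fin n) × U → EuclideanSpace ℝ (Fin n))
    (hf : Continuous f) (hfL : RegulatedCost.LocLipUnif f)
    (l : EuclideanSpace ℝ (Fin n) × U → ℝ)
    (hl : Continuous l) (hlL : RegulatedCost.LocLipUnif l) (hl0 : ∀ y, 0 ≤ l y)
    (p₀ γ : ℝ → ℝ) (W : EuclideanSpace ℝ (Fin n) → ℝ)
    (hW : RegulatedCost.IsMRF f l C p₀ γ W)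
    (z : EuclideanSpace ℝ (Fin n)) (hz : z ∉ C) :
    (W z : EReal) ≥
      ⨅ u ∈ RegulatedCost.admissibleControls f C z,
        ⨆ T ∈ {T : ℝ | 0 ≤ T ∧ (T : EReal) < RegulatedCost.targetTime f C z u},
          (((∫ t in (0 : ℝ)..T,
              (p₀ (W (RegulatedCost.trajectory f z u t))
                  * l (RegulatedCost.trajectory f z u t, u t)
                + γ (W (RegulatedCost.trajectory f z u t))))
            + W (RegulatedCost.trajectory f z u T) : ℝ) : EReal) := by
  refine le_of_forall_gt_imp_ge_of_dense fun c hc => ?_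
  obtain ⟨r, hr, hrc⟩ := EReal.lt_iff_exists_real_btwn.mp hc
  obtain ⟨u, hu, hcost⟩ := hW.exists_admissible_control hU hU' hC hC' hf hfL hl hl0 hz
    (sub_pos.mpr (EReal.coe_lt_coe_iff.mp hr))
  refine (iInf₂_le u hu).trans ((iSup₂_le fun T hT => ?_).trans hrc.le)
  have h := hcost T hT.1 hT.2
  rw [add_sub_cancel] at h
  exact EReal.coe_le_coe_iff.mpr h
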